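/- Let $k\ge 2$, let $T_1,\dots,T_k\colon I\to I$ be continuous maps of $I=[0,1]$, let $P=(p_{ij})$ be an irreducible $k\times k$ transition matrix (non-negative entries, rows summing to $1$) and let $\bar p=(p_1,\dots,p_k)$ be its stationary probability vector, $\bar pP=\bar p$ (all $p_i$ are positive). On $\Sigma_k^+=\{1,\dots,k\}^{\mathbb N}$, with shift $\sigma$ and cylinders $[a_0\dots a_n]=\{\xi:\xi_0=a_0,\dots,\xi_n=a_n\}$, let $\mathbb P^+$ be the Markov measure $\mathbb P^+([a_0\dots a_n])=p_{a_0}p_{a_0a_1}\cdots p_{a_{n-1}a_n}$, and let $\mathbb P^-$ be the inverse Markov measure, $\mathbb P^-([a_0\dots a_n])=\mathbb P^+([a_n\dots a_0])$, that is, the Markov measure of the transition matrix $q_{ij}=\frac{p_j}{p_i}p_{ji}$ and the vector $\bar p$. Assume that 1. $(\sigma,\mathbb P^-)$ is mixing: $\mathbb P^-$ is $\sigma$-invariant and $\mathbb P^-(\sigma^{-n}(A)\cap B)\to\mathbb P^-(A)\,\mathbb P^-(B)$ for all Borel sets $A,B$; 2. $\mathbb P^-$ splits the IFS in some non-trivial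 closed interval $J=[a,b]\subset I$, $a<b$: for every $i$, $T_i(J)\subset J$ and $T_i|_J$ is injective, and there are cylinders $[i_1\dots i_\ell]$ and $[j_1\dots j_s]$ of positive $\mathbb P^-$-measure with $i_1=j_1$ such that the sets $T_{i_1}\circ\dots\circ T_{i_\ell}(I)$ and $T_{j_1}\circ\dots\circ T_{j_s}(I)$ are disjoint and both contained in $J$. Let $S_{\mathrm t}$ be the set of $\xi\in\Sigma_k^+$ with $\operatorname{diam}(T_{\xi_0}\circ\dots\circ T_{\xi_n}(I))\to0$. For $\xi\in S_{\mathrm t}$ let $\pi(\xi)=\lim_n T_{\xi_0}\circ\dots\circ T_{\xi_n}(x)$ (the limit exists and does not depend on $x\in I$), and let $\varpi(\xi)=(\pi(\xi),\xi_0)\in\widehat X:=I\times\{1,\dots,k\}$. Let $\mathfrak S_{\mathbb P^+}$ be the generalised Markov operator on the space $\mathcal M_1(\widehat X)$ of Borel probability measures of $\widehat X$ with the weak-$*$ topology, $$\mathfrak S_{\mathbb P^+}(\widehat\mu)(\widehat B)=\sum_{i,j}p_{ij}\,T_{j*}\mu_i(\widehat B_j),\qquad \mu_i(B)=\widehat\mu(B\times\{i\}),\quad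 \widehat B_j=\{x:(x,j)\in\widehat B\}.$$ Then $\mathfrak S_{\mathbb P^+}$ is asymptotically stable (it has a stationary measure, that is, a fixed point, to which $\mathfrak S_{\mathbb P^+}^n\widehat\mu$ converges for every $\widehat\mu\in\mathcal M_1(\widehat X)$). Moreover $\mathbb P^-(S_{\mathrm t})=1$ and $\varpi$ is measurable, so that $\varpi_*\mathbb P^-$ is a well-defined probability measure on $\widehat X$. It is the unique stationary measure of $\mathfrak S_{\mathbb P^+}$, and $\mathfrak S_{\mathbb P^+}^n\widehat\mu\to\varpi_*\mathbb P^-$ weakly-$*$ for every $\widehat\mu\in\mathcal M_1(\widehat X)$. -/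

import Mathlib

open MeasureTheory ProbabilityTheory Filter Topology Set
open scoped ENNReal unitInterval

noncomputable section

namespace RecurrentIFS

/-! ### Markov measures on the one-sided shift over the symbols `Fin k` -/

/-- A transition matrix `P` on `k` symbols together with a stationary probability vector `p`. -/
structure MarkovData (k : ℕ) where
  /-- the transition matrix -/
  P : Matrix (Fin k) (Fin k) ℝ
  /-- the stationary probability vector -/
  p : Fin k → ℝ
  P_mem : P ∈ Matrix.rowStochastic ℝ (Fin k)
  p_mem : p ∈ stdSimplex ℝ (Fin k)
  stationary : Matrix.vecMul p P = p

variable {k : ℕ}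

/-- The one-sided shift. -/
def shift (ξ : ℕ → Fin k) : ℕ → Fin k := fun n => ξ (n + 1)

/-- The cylinder `[a₀ … aₙ]`, where the word is the initial segment of a sequence `a`. -/
def cyl (a : ℕ → Fin k) (n : ℕ) : Set (ℕ → Fin k) := {ξ | ∀ i ≤ n, ξ i = a i}

namespace MarkovData

variable (M : MarkovData k)

/-- The initial distribution `∑ i, pᵢ δᵢ`. -/
def init : Measure (Fin k) := ∑ i, ENNReal.ofReal (M.p i) • Measure.dirac i

/-- The distribution `∑ j, pᵢⱼ δⱼ` of the next symbol after the symbol `i`. -/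
def row (i : Fin k) : Measure (Fin k) := ∑ j, ENNReal.ofReal (M.P i j) • Measure.dirac j

theorem init_singleton (i : Fin k) : M.init {i} = ENNReal.ofReal (M.p i) := by
  simp [init, Measure.finsetSum_apply, Set.indicator_apply]

theorem row_singleton (i j : Fin k) : M.row i {j} = ENNReal.ofReal (M.P i j) := by
  simp [row, Measure.finsetSum_apply, Set.indicator_apply]

theorem P_nonneg (i j : Fin k) : 0 ≤ M.P i j := (Matrix.mem_rowStochastic_iff_sum.1 M.P_mem).1 i j

theorem P_row_sum (i : Fin k) : ∑ j, M.P i j = 1 := (Matrix.mem_rowStochastic_iff_sum.1 M.P_mem).2 i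

theorem p_nonneg (i : Fin k) : 0 ≤ M.p i := M.p_mem.1 i

theorem p_sum : ∑ i, M.p i = 1 := M.p_mem.2

instance : IsProbabilityMeasure M.init := ⟨by
  simp [init, Measure.finsetSum_apply, ← ENNReal.ofReal_sum_of_nonneg (fun i _ => M.p_nonneg i),
    M.p_sum]⟩

instance (i : Fin k) : IsProbabilityMeasure (M.row i) := ⟨by
  simp [row, Measure.finsetSum_apply, ← ENNReal.ofReal_sum_of_nonneg (fun j _ => M.P_nonneg i j),
    M.P_row_sum]⟩

/-- The transition kernel from the symbols up to time `n` to the symbol at time `n + 1`. -/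
def kernel (n : ℕ) : Kernel ((i : Finset.Iic n) → (fun _ : ℕ => Fin k) i) (Fin k) where
  toFun x := M.row (x ⟨n, Finset.mem_Iic.2 le_rfl⟩)
  measurable' := measurable_of_countable _

instance (n : ℕ) : IsMarkovKernel (M.kernel n) := ⟨fun x => by
  change IsProbabilityMeasure (M.row _); infer_instance⟩

/-- The Markov measure on `ℕ → Fin k` associated to `(P, p)`. -/
def measure : Measure (ℕ → Fin k) :=
  Kernel.trajMeasure (X := fun _ : ℕ => Fin k) M.init M.kernel

instance : IsProbabilityMeasure M.measure := by
  unfold measure; infer_instance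

theorem measure_cyl (a : ℕ → Fin k) (n : ℕ) :
    M.measure (cyl a n) =
      ENNReal.ofReal (M.p (a 0) * ∏ i ∈ Finset.range n, M.P (a i) (a (i + 1))) := by
  have hcyl : ∀ n, cyl a n = Preorder.frestrictLe (π := fun _ : ℕ => Fin k) n ⁻¹'
      {Preorder.frestrictLe (π := fun _ : ℕ => Fin k) n a} := fun n => by
    ext ξ
    simp [cyl, funext_iff]
  induction n with
  | zero =>
    have hm : M.measure.map (Preorder.frestrictLe (π := fun _ : ℕ => Fin k) 0) =
        M.init.map (MeasurableEquiv.piUnique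
          (fun i : Finset.Iic 0 => (fun _ : ℕ => Fin k) i)).symm := by
      rw [measure, Kernel.trajMeasure, Measure.map_comp _ _ (by fun_prop),
        Kernel.traj_map_frestrictLe, Kernel.partialTraj_self, Measure.id_comp]
    rw [hcyl, ← Measure.map_apply (by fun_prop) (measurableSet_singleton _), hm,
      Measure.map_apply (by fun_prop) (measurableSet_singleton _), Finset.prod_range_zero, mul_one,
      ← init_singleton]
    congr 1
    ext x
    simp only [mem_preimage, mem_singleton_iff]
    refine ⟨fun h => congrFun h ⟨0, Finset.mem_Iic.2 le_rfl⟩, fun h => ?_⟩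
    ext i
    obtain ⟨i, hi⟩ := i
    obtain rfl : i = 0 := by simpa using hi
    exact congrArg Fin.val h
  | succ n ih =>
    have h1 : cyl a (n + 1) =
        (fun ξ : ℕ → Fin k => (Preorder.frestrictLe (π := fun _ : ℕ => Fin k) n ξ, ξ (n + 1))) ⁻¹'
          ({Preorder.frestrictLe (π := fun _ : ℕ => Fin k) n a} ×ˢ {a (n + 1)}) := by
      rw [mk_preimage_prod, ← hcyl]
      ext ξ
      simp only [cyl, mem_ofPred_eq, mem_inter_iff, mem_preimage, mem_singleton_iff]
      exact ⟨fun h => ⟨fun i hi => h i (by lia), h _ le_rfl⟩, fun h i hi =>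
        (Nat.le_succ_iff.1 hi).elim (h.1 i) (fun e => e ▸ h.2)⟩
    have h2 := Kernel.map_frestrictLe_trajMeasure_compProd_eq_map_trajMeasure
      (X := fun _ : ℕ => Fin k) (μ₀ := M.init) (κ := M.kernel) (a := n)
    rw [h1, ← Measure.map_apply (by fun_prop)
      ((measurableSet_singleton _).prod (measurableSet_singleton _))]
    change (Measure.map _ (Kernel.trajMeasure (X := fun _ : ℕ => Fin k) M.init M.kernel)) _ = _
    rw [← h2, Measure.compProd_apply_prod (measurableSet_singleton _) (measurableSet_singleton _),
      lintegral_singleton, Measure.map_apply (by fun_prop) (measurableSet_singleton _), ← hcyl]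
    change M.row (a n) {a (n + 1)} * M.measure (cyl a n) = _
    rw [ih, row_singleton, ← ENNReal.ofReal_mul (M.P_nonneg _ _), Finset.prod_range_succ]
    congr 1
    ring

/-- The stationary vector of an irreducible matrix is positive. -/
theorem p_pos (h : M.P.IsIrreducible) (i : Fin k) : 0 < M.p i := by
  have hpow : ∀ n : ℕ, Matrix.vecMul M.p (M.P ^ n) = M.p := by
    intro n
    induction n with
    | zero => simp
    | succ n ih => rw [pow_succ, ← Matrix.vecMul_vecMul, ih, M.stationary]
  obtain ⟨j, hj⟩ : ∃ j, 0 < M.p j := by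
    by_contra! hc
    have := Finset.sum_nonpos (s := Finset.univ) (fun j _ => hc j)
    rw [M.p_sum] at this
    linarith
  obtain ⟨n, -, hn⟩ := (Matrix.isIrreducible_iff_exists_pow_pos M.P_nonneg).1 h j i
  have hpn := Matrix.pow_apply_nonneg M.P_nonneg n
  rw [← hpow n]
  exact Finset.sum_pos' (fun l _ => mul_nonneg (M.p_nonneg l) (hpn l i))
    ⟨j, Finset.mem_univ _, mul_pos hj hn⟩

/-- The inverse chain, with transition matrix `qᵢⱼ = (pⱼ / pᵢ) pⱼᵢ` and stationary vector `p`. -/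
def inverse (h : M.P.IsIrreducible) : MarkovData k where
  P := Matrix.of fun i j => M.p j / M.p i * M.P j i
  p := M.p
  P_mem := by
    refine Matrix.mem_rowStochastic_iff_sum.2 ⟨fun i j => ?_, fun i => ?_⟩
    · exact mul_nonneg (div_nonneg (M.p_nonneg j) (M.p_nonneg i)) (M.P_nonneg j i)
    · have hs : ∑ j, M.p j * M.P j i = M.p i := congrFun M.stationary i
      have hp := (M.p_pos h i).ne'
      calc ∑ j, M.p j / M.p i * M.P j i = (∑ j, M.p j * M.P j i) / M.p i := by
            rw [Finset.sum_div]; exact Finset.sum_congr rfl fun j _ => by ring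
        _ = 1 := by rw [hs, div_self hp]
  p_mem := M.p_mem
  stationary := by
    ext j
    change ∑ i, M.p i * (M.p j / M.p i * M.P j i) = M.p j
    have : ∀ i, M.p i * (M.p j / M.p i * M.P j i) = M.p j * M.P j i := fun i => by
      have hp := (M.p_pos h i).ne'
      field_simp
    simp only [this, ← Finset.mul_sum, M.P_row_sum, mul_one]

/-- The Markov measure of the inverse chain is the inverse Markov measure: it gives `[a₀ … aₙ]`
the mass that the original measure gives to `[aₙ … a₀]`. -/
theorem inverse_measure_cyl (h : M.P.IsIrreducible) (a : ℕ → Fin k) (n : ℕ) :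
    (M.inverse h).measure (cyl a n) = M.measure (cyl (fun i => a (n - i)) n) := by
  have key : ∀ m : ℕ, M.p (a 0) * ∏ i ∈ Finset.range m, (M.inverse h).P (a i) (a (i + 1)) =
      M.p (a m) * ∏ i ∈ Finset.range m, M.P (a (i + 1)) (a i) := fun m => by
    induction m with
    | zero => simp
    | succ m ih =>
      have hp := (M.p_pos h (a m)).ne'
      rw [Finset.prod_range_succ, ← mul_assoc, ih, Finset.prod_range_succ]
      change _ * (M.p (a (m + 1)) / M.p (a m) * M.P (a (m + 1)) (a m)) = _
      field_simp
  rw [measure_cyl, measure_cyl]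
  congr 1
  refine (key n).trans ?_
  rw [← Finset.prod_range_reflect]
  congr 1
  refine Finset.prod_congr rfl fun i hi => ?_
  have hi := Finset.mem_range.1 hi
  rw [show n - 1 - i + 1 = n - i by lia, show n - 1 - i = n - (i + 1) by lia]

end MarkovData

/-- The system `(T, μ)` is mixing. -/
def IsMixing {Ω : Type*} [MeasurableSpace Ω] (T : Ω → Ω) (μ : Measure Ω) : Prop :=
  MeasurePreserving T μ μ ∧ ∀ A B : Set Ω, MeasurableSet A → MeasurableSet B →
    Tendsto (fun n : ℕ => μ (T^[n] ⁻¹' A ∩ B)) atTop (𝓝 (μ A * μ B))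

/-- The section `μᵢ(B) = μ̂(B × {i})` of a measure on `X × Fin k`. -/
def sec {X : Type*} [MeasurableSpace X] (μ : Measure (X × Fin k)) (i : Fin k) : Measure X :=
  (μ.restrict (Prod.snd ⁻¹' {i})).map Prod.fst

theorem sec_apply {X : Type*} [MeasurableSpace X] (μ : Measure (X × Fin k)) (i : Fin k) {B : Set X} (hB : MeasurableSet B) :
    sec μ i B = μ (B ×ˢ {i}) := by
  rw [sec, Measure.map_apply measurable_fst hB, Measure.restrict_apply (measurable_fst hB)]
  rfl

/-! ### Weakly hyperbolic sequences and coding maps -/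

section IFS

variable {X : Type*} [MetricSpace X]

/-- The composition `T_{ξ₀} ∘ ⋯ ∘ T_{ξₙ}`. -/
def compSeq (T : Fin k → C(X, X)) (ξ : ℕ → Fin k) : ℕ → C(X, X)
  | 0 => T (ξ 0)
  | n + 1 => (compSeq T ξ n).comp (T (ξ (n + 1)))

/-- The set `S_t` of weakly hyperbolic sequences. -/
def weaklyHyperbolic (T : Fin k → C(X, X)) : Set (ℕ → Fin k) :=
  {ξ | Tendsto (fun n => Metric.diam (range (compSeq T ξ n))) atTop (𝓝 0)}

/-- The coding map `π(ξ) = lim T_{ξ₀} ∘ ⋯ ∘ T_{ξₙ}(x)` on `S_t`, with an arbitrary base point. -/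
def coding [Nonempty X] (T : Fin k → C(X, X)) (ξ : weaklyHyperbolic T) : X :=
  @limUnder _ _ _ _ atTop (fun n => compSeq T ξ.1 n (Classical.arbitrary X))

/-- On a compact space the limit that defines the coding map exists for every base point, and does
not depend on it. -/
theorem tendsto_coding [Nonempty X] [CompactSpace X] (T : Fin k → C(X, X)) (ξ : weaklyHyperbolic T)
    (x : X) : Tendsto (fun n => compSeq T ξ.1 n x) atTop (𝓝 (coding T ξ)) := by
  have hanti : Antitone fun n => range (compSeq T ξ.1 n) := antitone_nat_of_succ_le fun n => by
    rintro _ ⟨y, rfl⟩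
    exact ⟨T (ξ.1 (n + 1)) y, rfl⟩
  have hdist : ∀ (n m N : ℕ) (y z : X), N ≤ n → N ≤ m →
      dist (compSeq T ξ.1 n y) (compSeq T ξ.1 m z) ≤ Metric.diam (range (compSeq T ξ.1 N)) :=
    fun n m N y z hn hm => Metric.dist_le_diam_of_mem
      (isCompact_range (compSeq T ξ.1 N).continuous).isBounded
      (hanti hn (mem_range_self y)) (hanti hm (mem_range_self z))
  have hc : CauchySeq fun n => compSeq T ξ.1 n (Classical.arbitrary X) :=
    cauchySeq_of_le_tendsto_0 _ (fun n m N hn hm => hdist n m N _ _ hn hm) ξ.2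
  refine tendsto_of_tendsto_of_dist hc.tendsto_limUnder ?_
  exact squeeze_zero (fun n => dist_nonneg) (fun n => hdist n n n _ _ le_rfl le_rfl) ξ.2

/-- The generalised coding map `ϖ(ξ) = (π(ξ), ξ₀)`. -/
def genCoding [Nonempty X] (T : Fin k → C(X, X)) (ξ : weaklyHyperbolic T) : X × Fin k :=
  (coding T ξ, ξ.1 0)

/-! ### The generalised Markov operator -/

variable [MeasurableSpace X]

/-- The generalised Markov operator on measures: the `j`-th section of the image of `μ̂` is
`∑ i, pᵢⱼ T_{j*} μᵢ`. -/
def markovOp (T : Fin k → C(X, X)) (M : MarkovData k) (μ : Measure (X × Fin k)) :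
    Measure (X × Fin k) :=
  ∑ i, ∑ j, ENNReal.ofReal (M.P i j) • ((sec μ i).map (T j)).map (fun x => (x, j))

theorem markovOp_apply (T : Fin k → C(X, X)) (M : MarkovData k) (μ : Measure (X × Fin k))
    {B : Set (X × Fin k)} (hB : MeasurableSet B) :
    markovOp T M μ B =
      ∑ i, ∑ j, ENNReal.ofReal (M.P i j) * (sec μ i).map (T j) {x | (x, j) ∈ B} := by
  simp only [markovOp, Measure.finsetSum_apply, Measure.smul_apply, smul_eq_mul]
  refine Finset.sum_congr rfl fun i _ => Finset.sum_congr rfl fun j _ => ?_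
  rw [Measure.map_apply (by fun_prop) hB]
  rfl

instance [BorelSpace X] (T : Fin k → C(X, X)) (M : MarkovData k) (μ : Measure (X × Fin k))
    [IsProbabilityMeasure μ] : IsProbabilityMeasure (markovOp T M μ) := ⟨by
  have hu : (univ : Set (X × Fin k)) = ⋃ i ∈ (Finset.univ : Finset (Fin k)), univ ×ˢ {i} := by
    ext x
    simp
  calc markovOp T M μ univ = ∑ i, ∑ j, ENNReal.ofReal (M.P i j) * sec μ i univ := by
        rw [markovOp_apply T M μ MeasurableSet.univ]
        refine Finset.sum_congr rfl fun i _ => Finset.sum_congr rfl fun j _ => ?_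
        simp only [mem_univ, ofPred_true]
        rw [Measure.map_apply (T j).continuous.measurable MeasurableSet.univ, preimage_univ]
    _ = ∑ i, sec μ i univ := by
        refine Finset.sum_congr rfl fun i _ => ?_
        rw [← Finset.sum_mul, ← ENNReal.ofReal_sum_of_nonneg fun j _ => M.P_nonneg i j,
          M.P_row_sum, ENNReal.ofReal_one, one_mul]
    _ = ∑ i, μ (univ ×ˢ {i}) := Finset.sum_congr rfl fun i _ => sec_apply μ i MeasurableSet.univ
    _ = 1 := by
        rw [← measure_univ (μ := μ), hu, measure_biUnion_finset]
        · intro i _ j _ hij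
          exact disjoint_left.2 fun x hx hy => hij (hx.2.symm.trans hy.2)
        · exact fun i _ => MeasurableSet.univ.prod (measurableSet_singleton i)⟩

/-- The generalised Markov operator on the space of Borel probability measures of `X × Fin k`. -/
def markovOperator [BorelSpace X] (T : Fin k → C(X, X)) (M : MarkovData k)
    (μ : ProbabilityMeasure (X × Fin k)) : ProbabilityMeasure (X × Fin k) :=
  ⟨markovOp T M μ, inferInstance⟩

end IFS

/-- An operator on probability measures is asymptotically stable if it has a stationary measure to
which all its orbits converge weakly. -/
def IsAsymptoticallyStable {Y : Type*} [TopologicalSpace Y] [MeasurableSpace Y]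
    [OpensMeasurableSpace Y] (S : ProbabilityMeasure Y → ProbabilityMeasure Y) : Prop :=
  ∃ ν, S ν = ν ∧ ∀ μ, Tendsto (fun n : ℕ => S^[n] μ) atTop (𝓝 ν)

/-- The Markov measure of `M` splits the IFS `T` on `[0,1]` in the closed interval `[a, b]`. -/
def Splits (T : Fin k → C(I, I)) (M : MarkovData k) (a b : I) : Prop :=
  (∀ i, MapsTo (T i) (Icc a b) (Icc a b) ∧ InjOn (T i) (Icc a b)) ∧
  ∃ (u v : ℕ → Fin k) (l s : ℕ),
    0 < M.measure (cyl u l) ∧ 0 < M.measure (cyl v s) ∧ u 0 = v 0 ∧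
    Disjoint (range (compSeq T u l)) (range (compSeq T v s)) ∧
    range (compSeq T u l) ∪ range (compSeq T v s) ⊆ Icc a b

end RecurrentIFS

end

open RecurrentIFS

namespace RecurrentIFS

variable {k : ℕ}

/-! ### Cylinders and functions of finitely many symbols -/

theorem isOpen_cyl (a : ℕ → Fin k) (n : ℕ) : IsOpen (cyl a n) := by
  have : cyl a n = ⋂ i ∈ Set.Iic n, (fun ξ : ℕ → Fin k => ξ i) ⁻¹' {a i} := by
    ext ξ
    simp [cyl]
  rw [this]
  exact (Set.finite_Iic n).isOpen_biInter fun i _ =>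
    (isOpen_discrete _).preimage (continuous_apply i)

theorem measurableSet_cyl (a : ℕ → Fin k) (n : ℕ) : MeasurableSet (cyl a n) :=
  (isOpen_cyl a n).measurableSet

theorem mem_cyl_self (a : ℕ → Fin k) (n : ℕ) : a ∈ cyl a n := fun _ _ => rfl

theorem cyl_congr {a b : ℕ → Fin k} {n : ℕ} (h : ∀ i ≤ n, a i = b i) : cyl a n = cyl b n := by
  ext ξ
  exact forall₂_congr fun i hi => by rw [h i hi]

theorem frestrictLe_preimage_singleton (a : ℕ → Fin k) (n : ℕ) :
    Preorder.frestrictLe (π := fun _ : ℕ => Fin k) n ⁻¹'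
      {Preorder.frestrictLe (π := fun _ : ℕ => Fin k) n a} = cyl a n := by
  ext ξ
  simp [cyl, funext_iff]

theorem isOpen_preimage_of_dependsOn {β : Type*} {g : (ℕ → Fin k) → β} {n : ℕ}
    (hg : DependsOn g (Set.Iic n)) (s : Set β) : IsOpen (g ⁻¹' s) := by
  refine isOpen_iff_mem_nhds.2 fun ξ hξ => ?_
  filter_upwards [(isOpen_cyl ξ n).mem_nhds (mem_cyl_self ξ n)] with η hη
  rw [mem_preimage, hg fun i hi => hη i hi]
  exact hξ

theorem measurable_of_dependsOn {β : Type*} [MeasurableSpace β] {g : (ℕ → Fin k) → β} {n : ℕ}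
    (hg : DependsOn g (Set.Iic n)) : Measurable g := fun s _ =>
  (isOpen_preimage_of_dependsOn hg s).measurableSet

/-- A set of positive measure contains a sequence all of whose cylinders of a given length have
positive measure. -/
theorem exists_mem_measure_cyl_pos {μ : Measure (ℕ → Fin k)} {B : Set (ℕ → Fin k)} (hB : 0 < μ B)
    (n : ℕ) : ∃ a ∈ B, 0 < μ (cyl a n) := by
  by_contra! h
  exact hB.ne' (measure_null_of_locally_null B fun a ha =>
    ⟨cyl a n, mem_nhdsWithin_of_mem_nhds ((isOpen_cyl a n).mem_nhds (mem_cyl_self a n)),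
      le_antisymm (h a ha) bot_le⟩)

theorem map_frestrictLe_eq_of_cyl {μ ν : Measure (ℕ → Fin k)} {n : ℕ}
    (h : ∀ a, μ (cyl a n) = ν (cyl a n)) :
    μ.map (Preorder.frestrictLe (π := fun _ : ℕ => Fin k) n) =
      ν.map (Preorder.frestrictLe (π := fun _ : ℕ => Fin k) n) := by
  refine Measure.ext_of_singleton fun w => ?_
  rw [Measure.map_apply (by fun_prop) (measurableSet_singleton _),
    Measure.map_apply (by fun_prop) (measurableSet_singleton _)]
  by_cases hw : ∃ a, Preorder.frestrictLe (π := fun _ : ℕ => Fin k) n a = w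
  · obtain ⟨a, rfl⟩ := hw
    rw [frestrictLe_preimage_singleton, h]
  · have : Preorder.frestrictLe (π := fun _ : ℕ => Fin k) n ⁻¹' {w} = ∅ :=
      eq_empty_of_forall_notMem fun a ha => hw ⟨a, ha⟩
    rw [this, measure_empty, measure_empty]

/-- Measures that agree on the cylinders of length `n + 1` integrate functions of the first `n + 1`
symbols in the same way. -/
theorem integral_eq_of_cyl {μ ν : Measure (ℕ → Fin k)} {n : ℕ}
    (h : ∀ a, μ (cyl a n) = ν (cyl a n)) {g : (ℕ → Fin k) → ℝ} (hg : DependsOn g (Set.Iic n)) :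
    ∫ ξ, g ξ ∂μ = ∫ ξ, g ξ ∂ν := by
  let r := Preorder.frestrictLe (π := fun _ : ℕ => Fin k) n
  have hfac : Function.FactorsThrough g r := fun ξ η e => hg fun i hi =>
    congrFun e ⟨i, Finset.mem_Iic.2 hi⟩
  have hG : ∀ ξ, Function.extend r g 0 (r ξ) = g ξ := hfac.extend_apply 0
  have hr : Measurable r := by fun_prop
  have key : ∀ m : Measure (ℕ → Fin k), ∫ ξ, g ξ ∂m = ∫ w, Function.extend r g 0 w ∂(m.map r) := by
    intro m
    rw [integral_map hr.aemeasurable (measurable_of_countable _).aestronglyMeasurable]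
    simp only [hG]
  rw [key μ, key ν, map_frestrictLe_eq_of_cyl h]

/-- A lower bound for the conditional measure of `D` given every cylinder of `B` is a lower bound
for the conditional measure of `D` given `B`. -/
theorem mul_measure_le_of_cyl {μ : Measure (ℕ → Fin k)} {n : ℕ} {B D : Set (ℕ → Fin k)}
    (hB : DependsOn (· ∈ B) (Set.Iic n)) (δ : ℝ≥0∞)
    (h : ∀ a ∈ B, δ * μ (cyl a n) ≤ μ (cyl a n ∩ D)) : δ * μ B ≤ μ (B ∩ D) := by
  let r := Preorder.frestrictLe (π := fun _ : ℕ => Fin k) n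
  have hr : Measurable r := by fun_prop
  have key : ∀ m : Measure (ℕ → Fin k), m univ = ∑ w, m (r ⁻¹' {w}) := fun m => by
    rw [sum_measure_preimage_singleton _ fun w _ => hr (measurableSet_singleton w)]
    simp
  have hBm : MeasurableSet B := (isOpen_preimage_of_dependsOn hB {True}).measurableSet.congr (by
    ext; simp)
  rw [← Measure.restrict_apply_univ B, ← Measure.restrict_apply_univ (B ∩ D), key, key,
    Finset.mul_sum]
  refine Finset.sum_le_sum fun w _ => ?_
  rw [Measure.restrict_apply (hr (measurableSet_singleton w)),
    Measure.restrict_apply (hr (measurableSet_singleton w))]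
  rcases (r ⁻¹' {w} ∩ B).eq_empty_or_nonempty with he | ⟨a, rfl, ha⟩
  · rw [he, measure_empty, mul_zero]
    exact bot_le
  · have hsub : cyl a n ⊆ B := fun ξ hξ => (hB (x := ξ) (y := a) fun i hi => hξ i hi).mpr ha
    rw [frestrictLe_preimage_singleton, ← inter_assoc, inter_eq_self_of_subset_left hsub]
    exact h a ha

/-! ### The Markov property -/

namespace MarkovData

variable (M : MarkovData k)

theorem measure_symbol_zero (i : Fin k) : M.measure {ξ | ξ 0 = i} = ENNReal.ofReal (M.p i) := by
  have : {ξ : ℕ → Fin k | ξ 0 = i} = cyl (fun _ => i) 0 := by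
    ext ξ
    simp [cyl]
  rw [this, measure_cyl]
  simp

theorem measurableSet_symbol (n : ℕ) (i : Fin k) : MeasurableSet {ξ : ℕ → Fin k | ξ n = i} :=
  (measurableSet_singleton i).preimage (measurable_pi_apply n)

theorem measure_cyl_inter_symbol_succ (a : ℕ → Fin k) (n : ℕ) (i : Fin k) :
    M.measure (cyl a n ∩ {ξ | ξ (n + 1) = i}) =
      ENNReal.ofReal (M.P (a n) i) * M.measure (cyl a n) := by
  have h : cyl a n ∩ {ξ | ξ (n + 1) = i} = cyl (Function.update a (n + 1) i) (n + 1) := by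
    ext ξ
    refine ⟨fun ⟨h1, h2⟩ t ht => ?_, fun h => ⟨fun t ht => ?_, ?_⟩⟩
    · rcases Nat.le_succ_iff.1 ht with ht | rfl
      · rw [Function.update_of_ne (by lia)]
        exact h1 t ht
      · rw [Function.update_self]
        exact h2
    · have := h t (by lia)
      rwa [Function.update_of_ne (by lia)] at this
    · have := h (n + 1) le_rfl
      rwa [Function.update_self] at this
  rw [h, measure_cyl, measure_cyl, ← ENNReal.ofReal_mul (M.P_nonneg _ _), Finset.prod_range_succ]
  congr 1
  rw [Function.update_self, Function.update_of_ne (by lia), Function.update_of_ne (by lia)]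
  rw [Finset.prod_congr rfl (g := fun t => M.P (a t) (a (t + 1))) fun t ht => ?_]
  · ring
  · have := Finset.mem_range.1 ht
    rw [Function.update_of_ne (by lia), Function.update_of_ne (by lia)]

theorem setIntegral_symbol_succ {g : (ℕ → Fin k) → ℝ} {n : ℕ} (hg : DependsOn g (Set.Iic n))
    (hi : Integrable g M.measure) (i : Fin k) :
    ∫ ξ in {ξ | ξ (n + 1) = i}, g ξ ∂M.measure =
      ∑ j, M.P j i * ∫ ξ in {ξ | ξ n = j}, g ξ ∂M.measure := by
  have h := integral_eq_of_cyl (μ := M.measure.restrict {ξ | ξ (n + 1) = i})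
    (ν := ∑ j, ENNReal.ofReal (M.P j i) • M.measure.restrict {ξ | ξ n = j}) (fun a => by
      have h : cyl a n ⊆ {ξ | ξ n = a n} := fun ξ hξ => hξ n le_rfl
      rw [Measure.restrict_apply (measurableSet_cyl a n), measure_cyl_inter_symbol_succ,
        Measure.finsetSum_apply, Finset.sum_eq_single (a n)]
      · rw [Measure.smul_apply, Measure.restrict_apply (measurableSet_cyl a n),
          inter_eq_self_of_subset_left h, smul_eq_mul]
      · intro j _ hj
        have : cyl a n ∩ {ξ | ξ n = j} = ∅ := eq_empty_of_forall_notMem fun ξ hξ =>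
          hj (hξ.2.symm.trans (hξ.1 n le_rfl))
        rw [Measure.smul_apply, Measure.restrict_apply (measurableSet_cyl a n), this,
          measure_empty, smul_zero]
      · simp) hg
  rw [h, integral_finsetSum_measure fun j _ =>
    (hi.restrict).smul_measure ENNReal.ofReal_ne_top]
  refine Finset.sum_congr rfl fun j _ => ?_
  rw [integral_smul_measure, ENNReal.toReal_ofReal (M.P_nonneg _ _), smul_eq_mul]

/-- The measure of the cylinder of a word that is continued by another word. -/
theorem measure_cyl_append (a b c : ℕ → Fin k) (n m : ℕ) (hca : ∀ t ≤ n, c t = a t)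
    (hcb : ∀ t ≤ m, c (n + t) = b t) :
    M.measure (cyl c (n + m)) =
      ENNReal.ofReal (∏ t ∈ Finset.range m, M.P (b t) (b (t + 1))) * M.measure (cyl a n) := by
  have h : ∏ t ∈ Finset.range m, M.P (c (n + t)) (c (n + t + 1)) =
      ∏ t ∈ Finset.range m, M.P (b t) (b (t + 1)) := Finset.prod_congr rfl fun t ht => by
    have := Finset.mem_range.1 ht
    rw [hcb t (by lia), add_assoc, hcb (t + 1) (by lia)]
  rw [← cyl_congr hca, measure_cyl, measure_cyl,
    ← ENNReal.ofReal_mul (Finset.prod_nonneg fun _ _ => M.P_nonneg _ _), Finset.prod_range_add]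
  simp only [← h, add_assoc]
  congr 1
  ring

theorem prod_pos_of_measure_cyl_pos {a : ℕ → Fin k} {n : ℕ} (h : 0 < M.measure (cyl a n)) :
    0 < ∏ t ∈ Finset.range n, M.P (a t) (a (t + 1)) := by
  rw [measure_cyl, ENNReal.ofReal_pos] at h
  exact pos_of_mul_pos_right h (M.p_nonneg _)

end MarkovData

/-! ### Mixing for integrable functions -/

theorem IsMixing.tendsto_setIntegral {Ω : Type*} [MeasurableSpace Ω] {τ : Ω → Ω} {μ : Measure Ω}
    [IsFiniteMeasure μ] (h : IsMixing τ μ) {A : Set Ω} (hA : MeasurableSet A) {g : Ω → ℝ}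
    (hg : Integrable g μ) :
    Tendsto (fun n : ℕ => ∫ ω in τ^[n] ⁻¹' A, g ω ∂μ) atTop (𝓝 (μ.real A * ∫ ω, g ω ∂μ)) := by
  have hmeas : ∀ n, MeasurableSet (τ^[n] ⁻¹' A) := fun n => (h.1.measurable.iterate n) hA
  refine Integrable.induction (fun g : Ω → ℝ => Tendsto (fun n : ℕ => ∫ ω in τ^[n] ⁻¹' A, g ω ∂μ)
    atTop (𝓝 (μ.real A * ∫ ω, g ω ∂μ))) ?_ ?_ ?_ ?_ hg
  · intro c s hs _
    have h1 : ∀ n, ∫ ω in τ^[n] ⁻¹' A, s.indicator (fun _ => c) ω ∂μ =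
        μ.real (τ^[n] ⁻¹' A ∩ s) * c := fun n => by
      rw [integral_indicator hs, setIntegral_const, smul_eq_mul, measureReal_def,
        Measure.restrict_apply hs, inter_comm, measureReal_def]
    rw [integral_indicator hs, setIntegral_const, smul_eq_mul, ← mul_assoc]
    simp only [h1]
    refine Tendsto.mul_const c ?_
    have := (ENNReal.tendsto_toReal (ENNReal.mul_ne_top (measure_ne_top μ A)
      (measure_ne_top μ s))).comp (h.2 A s hA hs)
    rwa [ENNReal.toReal_mul] at this
  · intro f g _ hf hg hf' hg'
    simp only [Pi.add_apply]
    rw [integral_add hf hg, mul_add]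
    refine (hf'.add hg').congr fun n => ?_
    rw [integral_add hf.integrableOn hg.integrableOn]
  · refine isClosed_of_closure_subset fun f hf => ?_
    rw [mem_ofPred_eq, Metric.tendsto_atTop]
    intro ε hε
    set c := μ.real A with hc
    have hc0 : 0 ≤ c := measureReal_nonneg
    obtain ⟨g, hg, hfg⟩ := Metric.mem_closure_iff.1 hf (ε / (2 * (c + 2))) (by positivity)
    obtain ⟨N, hN⟩ := Metric.tendsto_atTop.1 hg (ε / 2) (by positivity)
    have hfi := L1.integrable_coeFn f
    have hgi := L1.integrable_coeFn g
    have hbound : ∀ s : Set Ω, |∫ ω in s, f ω ∂μ - ∫ ω in s, g ω ∂μ| ≤ dist f g := fun s => by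
      rw [← integral_sub hfi.integrableOn hgi.integrableOn, L1.dist_eq_integral_dist]
      refine (abs_integral_le_integral_abs).trans ?_
      simp only [Real.dist_eq]
      exact setIntegral_le_integral (hfi.sub hgi).abs (Eventually.of_forall fun _ => abs_nonneg _)
    refine ⟨N, fun n hn => ?_⟩
    have h1 := hbound (τ^[n] ⁻¹' A)
    have h2 := hbound univ
    rw [setIntegral_univ, setIntegral_univ] at h2
    have h3 := hN n hn
    rw [Real.dist_eq] at h3 ⊢
    have h4 : dist f g * (c + 2) < ε / 2 := by
      rw [lt_div_iff₀ (by positivity)] at hfg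
      linarith
    have h5 : c * |∫ ω, f ω ∂μ - ∫ ω, g ω ∂μ| ≤ c * dist f g := by gcongr
    have h6 := abs_mul c (∫ ω, f ω ∂μ - ∫ ω, g ω ∂μ)
    rw [abs_of_nonneg hc0] at h6
    have hd : 0 ≤ dist f g := dist_nonneg
    rw [abs_lt] at h3 ⊢
    rw [abs_le] at h1
    rw [← h6, abs_le] at h5
    constructor <;> nlinarith [h1.1, h1.2, h5.1, h5.2, h3.1, h3.2]
  · intro f g hfg _ hf
    rw [← integral_congr_ae hfg]
    exact hf.congr fun n => integral_congr_ae (ae_restrict_of_ae hfg)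

theorem shift_iterate_apply (n : ℕ) (ξ : ℕ → Fin k) (m : ℕ) : shift^[n] ξ m = ξ (m + n) := by
  induction n generalizing ξ with
  | zero => rfl
  | succ n ih => rw [Function.iterate_succ_apply, ih]; rfl

/-! ### The dual operator on continuous functions -/

section Dual

variable {X : Type*} [MetricSpace X]

/-- The dual of the generalised Markov operator, acting on continuous functions. -/
noncomputable def dualOp (T : Fin k → C(X, X)) (M : MarkovData k) (f : C(X × Fin k, ℝ)) :
    C(X × Fin k, ℝ) where
  toFun x := ∑ j, M.P x.2 j * f (T j x.1, j)
  continuous_toFun := continuous_finsetSum _ fun j _ =>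
    ((continuous_of_discreteTopology (f := fun i => M.P i j)).comp continuous_snd).mul
      (by fun_prop)

theorem dualOp_apply (T : Fin k → C(X, X)) (M : MarkovData k) (f : C(X × Fin k, ℝ)) (x : X)
    (i : Fin k) : dualOp T M f (x, i) = ∑ j, M.P i j * f (T j x, j) := rfl

theorem abs_dualOp_iterate_le (T : Fin k → C(X, X)) (M : MarkovData k) {f : C(X × Fin k, ℝ)}
    {C : ℝ} (hf : ∀ x, |f x| ≤ C) (n : ℕ) (x : X × Fin k) : |(dualOp T M)^[n] f x| ≤ C := by
  induction n generalizing x with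
  | zero => exact hf x
  | succ n ih =>
    rw [Function.iterate_succ_apply', ← Prod.mk.eta (p := x), dualOp_apply]
    calc _ ≤ ∑ j, |M.P x.2 j * (dualOp T M)^[n] f (T j x.1, j)| := Finset.abs_sum_le_sum_abs _ _
      _ ≤ ∑ j, M.P x.2 j * C := Finset.sum_le_sum fun j _ => by
          rw [abs_mul, abs_of_nonneg (M.P_nonneg _ _)]
          exact mul_le_mul_of_nonneg_left (ih _) (M.P_nonneg _ _)
      _ = C := by rw [← Finset.sum_mul, M.P_row_sum, one_mul]

variable [CompactSpace X] [MeasurableSpace X] [BorelSpace X]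

theorem integrable_continuousMap {Y : Type*} [TopologicalSpace Y] [CompactSpace Y]
    [MeasurableSpace Y] [OpensMeasurableSpace Y] (μ : Measure Y)
    [IsFiniteMeasure μ] (f : C(Y, ℝ)) : Integrable f μ :=
  (BoundedContinuousFunction.mkOfCompact f).integrable μ

theorem integral_markovOp (T : Fin k → C(X, X)) (M : MarkovData k) (μ : Measure (X × Fin k))
    [IsProbabilityMeasure μ] (f : C(X × Fin k, ℝ)) :
    ∫ y, f y ∂(markovOp T M μ) = ∫ y, dualOp T M f y ∂μ := by
  have hfi : ∀ i j, Integrable f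
      (ENNReal.ofReal (M.P i j) • ((sec μ i).map (T j)).map (fun x => (x, j))) := fun i j => by
    have : IsFiniteMeasure (sec μ i) := by unfold sec; infer_instance
    exact (integrable_continuousMap _ f).smul_measure ENNReal.ofReal_ne_top
  have hset : ∀ i : Fin k, MeasurableSet (Prod.snd ⁻¹' {i} : Set (X × Fin k)) := fun i =>
    measurable_snd (measurableSet_singleton i)
  have hterm : ∀ i j, ∫ y, f y ∂(ENNReal.ofReal (M.P i j) •
      ((sec μ i).map (T j)).map (fun x => (x, j))) =
      ∫ y in Prod.snd ⁻¹' {i}, M.P i j * f (T j y.1, j) ∂μ := fun i j => by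
    rw [integral_smul_measure, ENNReal.toReal_ofReal (M.P_nonneg _ _), smul_eq_mul,
      integral_const_mul, integral_map (by fun_prop)
        f.continuous.stronglyMeasurable.aestronglyMeasurable,
      integral_map (T j).continuous.measurable.aemeasurable
        (Continuous.stronglyMeasurable (by fun_prop)).aestronglyMeasurable,
      sec, integral_map (by fun_prop)
        (Continuous.stronglyMeasurable (by fun_prop)).aestronglyMeasurable]
  rw [markovOp, integral_finsetSum_measure fun i _ => integrable_finsetSum_measure.2 fun j _ => hfi i j]
  have huniv : (⋃ i : Fin k, (Prod.snd ⁻¹' {i} : Set (X × Fin k))) = univ := by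
    ext; simp
  rw [← setIntegral_univ (μ := μ), ← huniv, integral_iUnion_fintype hset
    (fun i j hij => disjoint_left.2 fun x hx hy => hij (hx.symm.trans hy))
    fun i => (integrable_continuousMap μ (dualOp T M f)).integrableOn]
  refine Finset.sum_congr rfl fun i _ => ?_
  rw [integral_finsetSum_measure fun j _ => hfi i j]
  simp only [hterm]
  rw [← integral_finsetSum]
  · refine setIntegral_congr_fun (hset i) fun y hy => ?_
    obtain rfl : y.2 = i := hy
    rfl
  · intro j _
    exact (integrable_continuousMap μ
      ⟨fun y => M.P i j * f (T j y.1, j), by fun_prop⟩).integrableOn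

theorem integral_markovOperator_iterate (T : Fin k → C(X, X)) (M : MarkovData k) (n : ℕ)
    (μ : ProbabilityMeasure (X × Fin k)) (f : C(X × Fin k, ℝ)) :
    ∫ y, f y ∂((markovOperator T M)^[n] μ : ProbabilityMeasure (X × Fin k)) =
      ∫ y, (dualOp T M)^[n] f y ∂μ := by
  induction n generalizing f with
  | zero => rfl
  | succ n ih =>
    rw [Function.iterate_succ_apply', Function.iterate_succ_apply, ← ih]
    exact integral_markovOp T M _ f

theorem continuous_markovOperator (T : Fin k → C(X, X)) (M : MarkovData k) :
    Continuous (markovOperator T M) := by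
  refine continuous_iff_continuousAt.2 fun μ =>
    ProbabilityMeasure.tendsto_iff_forall_integral_tendsto.2 fun f => ?_
  have h := ProbabilityMeasure.tendsto_iff_forall_integral_tendsto.1 (tendsto_id (x := 𝓝 μ))
    (BoundedContinuousFunction.mkOfCompact (dualOp T M f.toContinuousMap))
  have key : ∀ ν : ProbabilityMeasure (X × Fin k),
      ∫ y, f y ∂(markovOperator T M ν : Measure (X × Fin k)) =
        ∫ y, dualOp T M f.toContinuousMap y ∂(ν : Measure (X × Fin k)) := fun ν =>
    integral_markovOp T M ν f.toContinuousMap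
  simp only [key]
  exact h

end Dual

/-! ### The orbits of the dual operator and the inverse chain -/

section Orbits

variable {X : Type*} [MetricSpace X]

/-- The composition `T_{ξ₀} ∘ ⋯ ∘ T_{ξₙ₋₁}` of the first `n` maps. -/
def prefixComp (T : Fin k → C(X, X)) (ξ : ℕ → Fin k) : ℕ → X → X
  | 0 => id
  | n + 1 => compSeq T ξ n

theorem prefixComp_apply_succ (T : Fin k → C(X, X)) (ξ : ℕ → Fin k) (n : ℕ) (x : X) :
    prefixComp T ξ (n + 1) x = prefixComp T ξ n (T (ξ n) x) := by
  cases n <;> rfl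

theorem compSeq_congr (T : Fin k → C(X, X)) {ξ η : ℕ → Fin k} {n : ℕ} (h : ∀ i ≤ n, ξ i = η i) :
    compSeq T ξ n = compSeq T η n := by
  induction n with
  | zero => simp only [compSeq, h 0 le_rfl]
  | succ n ih => simp only [compSeq, ih fun i hi => h i (by lia), h (n + 1) le_rfl]

theorem dependsOn_prefixComp {β : Type*} (T : Fin k → C(X, X)) (f : X × Fin k → β) (n : ℕ)
    (x : X) : DependsOn (fun ξ : ℕ → Fin k => f (prefixComp T ξ (n + 1) x, ξ 0)) (Set.Iic n) := by
  intro ξ η h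
  simp only [prefixComp]
  rw [compSeq_congr T fun i hi => h i hi, h 0 (mem_Iic.2 (Nat.zero_le n))]

theorem measurable_prefixComp (T : Fin k → C(X, X)) (f : X × Fin k → ℝ) (n : ℕ) (x : X) :
    Measurable (fun ξ : ℕ → Fin k => f (prefixComp T ξ n x, ξ 0)) := by
  cases n with
  | zero => exact (measurable_of_countable (fun i => f (x, i))).comp (measurable_pi_apply 0)
  | succ n => exact measurable_of_dependsOn (dependsOn_prefixComp T f n x)

theorem integrable_prefixComp [CompactSpace X] (T : Fin k → C(X, X)) (f : C(X × Fin k, ℝ)) (n : ℕ)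
    (x : X) (μ : Measure (ℕ → Fin k)) [IsFiniteMeasure μ] :
    Integrable (fun ξ : ℕ → Fin k => f (prefixComp T ξ n x, ξ 0)) μ :=
  Integrable.of_bound (measurable_prefixComp T f n x).aestronglyMeasurable ‖f‖
    (Eventually.of_forall fun _ => f.norm_coe_le_norm _)

theorem mul_dualOp_iterate [CompactSpace X] (T : Fin k → C(X, X)) (M : MarkovData k)
    (hirr : M.P.IsIrreducible) (f : C(X × Fin k, ℝ)) (n : ℕ) (x : X) (i : Fin k) :
    M.p i * (dualOp T M)^[n] f (x, i) =
      ∫ ξ in {ξ | ξ n = i}, f (prefixComp T ξ n x, ξ 0) ∂(M.inverse hirr).measure := by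
  induction n generalizing x i with
  | zero =>
    rw [setIntegral_congr_fun (g := fun _ => f (x, i)) (MarkovData.measurableSet_symbol 0 i)
      fun ξ hξ => ?_, setIntegral_const, measureReal_def, MarkovData.measure_symbol_zero,
      ENNReal.toReal_ofReal ((M.inverse hirr).p_nonneg i)]
    · rfl
    · rw [mem_ofPred_eq] at hξ
      simp only [prefixComp, hξ, id]
  | succ n ih =>
    rw [(M.inverse hirr).setIntegral_symbol_succ (dependsOn_prefixComp T f n x)
      (integrable_prefixComp T f (n + 1) x _), Function.iterate_succ_apply', dualOp_apply,
      Finset.mul_sum]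
    refine Finset.sum_congr rfl fun j _ => ?_
    have h1 : ∫ ξ in {ξ | ξ n = j}, f (prefixComp T ξ (n + 1) x, ξ 0) ∂(M.inverse hirr).measure =
        M.p j * (dualOp T M)^[n] f (T j x, j) := by
      rw [ih]
      refine setIntegral_congr_fun (MarkovData.measurableSet_symbol n j) fun ξ hξ => ?_
      rw [mem_ofPred_eq] at hξ
      simp only [prefixComp_apply_succ, hξ]
    have hp := (M.p_pos hirr j).ne'
    rw [h1]
    change _ = M.p i / M.p j * M.P i j * _
    field_simp

theorem measurableSet_weaklyHyperbolic (T : Fin k → C(X, X)) :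
    MeasurableSet (weaklyHyperbolic T) :=
  measurableSet_tendsto (𝓝 0) fun n => measurable_of_dependsOn (n := n) fun ξ η h => by
    rw [compSeq_congr T fun i hi => h i hi]

variable [Nonempty X]

/-- The limit of `T_{ξ₀} ∘ ⋯ ∘ T_{ξₙ}` at an arbitrary base point, whether it exists or not, paired
with the first symbol; it extends the generalised coding map. -/
noncomputable def genCodingExt (T : Fin k → C(X, X)) (ξ : ℕ → Fin k) : X × Fin k :=
  (@limUnder _ _ _ _ atTop (fun n => compSeq T ξ n (Classical.arbitrary X)), ξ 0)

theorem genCoding_eq (T : Fin k → C(X, X)) (ξ : weaklyHyperbolic T) :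
    genCoding T ξ = genCodingExt T ξ := rfl

variable [CompactSpace X]

theorem tendsto_prefixComp (T : Fin k → C(X, X)) (f : C(X × Fin k, ℝ)) {ξ : ℕ → Fin k}
    (hξ : ξ ∈ weaklyHyperbolic T) (x : X) :
    Tendsto (fun n => f (prefixComp T ξ n x, ξ 0)) atTop (𝓝 (f (genCodingExt T ξ))) := by
  refine (tendsto_add_atTop_iff_nat 1).1 ?_
  exact (f.continuous.tendsto _).comp
    ((tendsto_coding T ⟨ξ, hξ⟩ x).prodMk_nhds tendsto_const_nhds)

theorem tendsto_dualOp_iterate (T : Fin k → C(X, X)) (M : MarkovData k)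
    (hirr : M.P.IsIrreducible) (hmix : IsMixing shift (M.inverse hirr).measure)
    (hT : ∀ᵐ ξ ∂(M.inverse hirr).measure, ξ ∈ weaklyHyperbolic T) (f : C(X × Fin k, ℝ))
    (y : X × Fin k) :
    Tendsto (fun n => (dualOp T M)^[n] f y) atTop
      (𝓝 (∫ ξ, f (genCodingExt T ξ) ∂(M.inverse hirr).measure)) := by
  obtain ⟨x, i⟩ := y
  set μ := (M.inverse hirr).measure with hμ
  have hlim : ∀ᵐ ξ ∂μ, Tendsto (fun n => f (prefixComp T ξ n x, ξ 0)) atTop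
      (𝓝 (f (genCodingExt T ξ))) := hT.mono fun ξ hξ => tendsto_prefixComp T f hξ x
  have hgm : AEStronglyMeasurable (fun ξ => f (genCodingExt T ξ)) μ :=
    aestronglyMeasurable_of_tendsto_ae atTop
      (fun n => (measurable_prefixComp T f n x).aestronglyMeasurable) hlim
  have hgi : Integrable (fun ξ => f (genCodingExt T ξ)) μ :=
    Integrable.of_bound hgm ‖f‖ (Eventually.of_forall fun _ => f.norm_coe_le_norm _)
  have hmain : Tendsto (fun n => ∫ ξ in {ξ | ξ n = i}, f (genCodingExt T ξ) ∂μ) atTop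
      (𝓝 (M.p i * ∫ ξ, f (genCodingExt T ξ) ∂μ)) := by
    have h := hmix.tendsto_setIntegral (MarkovData.measurableSet_symbol 0 i) hgi
    rw [measureReal_def, MarkovData.measure_symbol_zero,
      ENNReal.toReal_ofReal ((M.inverse hirr).p_nonneg i)] at h
    refine h.congr fun n => ?_
    have : shift^[n] ⁻¹' {ξ : ℕ → Fin k | ξ 0 = i} = {ξ | ξ n = i} := by
      ext ξ
      simp [shift_iterate_apply]
    rw [this]
  have herr : Tendsto (fun n => ∫ ξ, |f (prefixComp T ξ n x, ξ 0) - f (genCodingExt T ξ)| ∂μ)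
      atTop (𝓝 0) := by
    have h := tendsto_integral_of_dominated_convergence (μ := μ)
      (F := fun n ξ => |f (prefixComp T ξ n x, ξ 0) - f (genCodingExt T ξ)|) (f := fun _ => 0)
      (fun _ => ‖f‖ + ‖f‖)
      (fun n => ((measurable_prefixComp T f n x).aestronglyMeasurable.sub hgm).norm)
      (integrable_const _)
      (fun n => Eventually.of_forall fun ξ => by
        rw [Real.norm_eq_abs, abs_abs]
        exact (norm_sub_le _ _).trans
          (add_le_add (f.norm_coe_le_norm _) (f.norm_coe_le_norm _)))
      (hlim.mono fun ξ hξ => by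
        have := (hξ.sub_const (f (genCodingExt T ξ))).abs
        rwa [sub_self, abs_zero] at this)
    rwa [integral_zero] at h
  have hdiff : Tendsto (fun n => ∫ ξ in {ξ | ξ n = i}, f (prefixComp T ξ n x, ξ 0) ∂μ -
      ∫ ξ in {ξ | ξ n = i}, f (genCodingExt T ξ) ∂μ) atTop (𝓝 0) := by
    refine squeeze_zero_norm (fun n => ?_) herr
    have hi := integrable_prefixComp T f n x μ
    rw [← integral_sub hi.integrableOn hgi.integrableOn]
    exact (norm_integral_le_integral_norm _).trans
      (setIntegral_le_integral (hi.sub hgi).abs (Eventually.of_forall fun _ => abs_nonneg _))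
  have hsum := hdiff.add hmain
  simp only [sub_add_cancel, zero_add, hμ, ← mul_dualOp_iterate T M hirr f] at hsum
  have hp := (M.p_pos hirr i).ne'
  have := hsum.const_mul (M.p i)⁻¹
  simpa only [inv_mul_cancel_left₀ hp] using this

variable [MeasurableSpace X] [BorelSpace X]

theorem measurable_genCoding (T : Fin k → C(X, X)) : Measurable (genCoding T) := by
  refine Measurable.prodMk ?_ ((measurable_pi_apply 0).comp measurable_subtype_coe)
  refine measurable_of_tendsto_metrizable
    (f := fun n (ξ : weaklyHyperbolic T) => compSeq T ξ n (Classical.arbitrary X)) (fun n => ?_)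
    (tendsto_pi_nhds.2 fun ξ => tendsto_coding T ξ _)
  have : Measurable fun ξ : ℕ → Fin k => compSeq T ξ n (Classical.arbitrary X) :=
    measurable_of_dependsOn (n := n) fun ξ η h => by rw [compSeq_congr T fun i hi => h i hi]
  exact this.comp measurable_subtype_coe

/-- The law of the generalised coding map. -/
noncomputable def codingLaw (T : Fin k → C(X, X)) (μ : Measure (ℕ → Fin k)) :
    Measure (X × Fin k) :=
  (μ.comap (Subtype.val : weaklyHyperbolic T → ℕ → Fin k)).map (genCoding T)

theorem integral_codingLaw (T : Fin k → C(X, X)) {μ : Measure (ℕ → Fin k)}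
    (hT : ∀ᵐ ξ ∂μ, ξ ∈ weaklyHyperbolic T) (f : C(X × Fin k, ℝ)) :
    ∫ y, f y ∂(codingLaw T μ) = ∫ ξ, f (genCodingExt T ξ) ∂μ := by
  rw [codingLaw, integral_map (measurable_genCoding T).aemeasurable
    f.continuous.stronglyMeasurable.aestronglyMeasurable]
  simp only [genCoding_eq]
  rw [integral_subtype_comap (measurableSet_weaklyHyperbolic T) fun ξ => f (genCodingExt T ξ),
    Measure.restrict_eq_self_of_ae_mem hT]

theorem isProbabilityMeasure_codingLaw (T : Fin k → C(X, X)) {μ : Measure (ℕ → Fin k)}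
    (hT : μ (weaklyHyperbolic T) = 1) : IsProbabilityMeasure (codingLaw T μ) := ⟨by
  rw [codingLaw, Measure.map_apply (measurable_genCoding T) MeasurableSet.univ, preimage_univ,
    comap_subtype_coe_apply (measurableSet_weaklyHyperbolic T), image_univ, Subtype.range_coe, hT]⟩

/-- If the inverse chain is mixing and almost all of its orbits are weakly hyperbolic, then all
orbits of the generalised Markov operator converge to the law of the generalised coding map. -/
theorem tendsto_markovOperator_iterate (T : Fin k → C(X, X)) (M : MarkovData k)
    (hirr : M.P.IsIrreducible) (hmix : IsMixing shift (M.inverse hirr).measure)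
    (hT : ∀ᵐ ξ ∂(M.inverse hirr).measure, ξ ∈ weaklyHyperbolic T)
    (ν : ProbabilityMeasure (X × Fin k))
    (hν : (ν : Measure (X × Fin k)) = codingLaw T (M.inverse hirr).measure)
    (μ : ProbabilityMeasure (X × Fin k)) :
    Tendsto (fun n : ℕ => (markovOperator T M)^[n] μ) atTop (𝓝 ν) := by
  refine ProbabilityMeasure.tendsto_iff_forall_integral_tendsto.2 fun f => ?_
  have hf := integral_codingLaw T hT f.toContinuousMap
  rw [← hν] at hf
  change ∫ y, f y ∂(ν : Measure (X × Fin k)) = _ at hf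
  rw [hf]
  have h := tendsto_integral_of_dominated_convergence (μ := (μ : Measure (X × Fin k)))
    (F := fun n => (dualOp T M)^[n] f.toContinuousMap)
    (f := fun _ => ∫ ξ, f.toContinuousMap (genCodingExt T ξ) ∂(M.inverse hirr).measure)
    (fun _ => ‖f‖) (fun n => (ContinuousMap.continuous _).stronglyMeasurable.aestronglyMeasurable)
    (integrable_const _)
    (fun n => Eventually.of_forall (abs_dualOp_iterate_le T M (fun x => f.norm_coe_le_norm x) n))
    (Eventually.of_forall (tendsto_dualOp_iterate T M hirr hmix hT f.toContinuousMap))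
  rw [integral_const, probReal_univ, one_smul] at h
  exact h.congr fun n => (integral_markovOperator_iterate T M n μ f.toContinuousMap).symm

theorem fixed_iff_of_tendsto_iterate {Y : Type*} [TopologicalSpace Y] [T2Space Y] {S : Y → Y}
    (hS : Continuous S) {ν : Y} (h : ∀ μ, Tendsto (fun n : ℕ => S^[n] μ) atTop (𝓝 ν)) (μ : Y) :
    S μ = μ ↔ μ = ν := by
  refine ⟨fun hμ => ?_, ?_⟩
  · refine tendsto_nhds_unique ?_ (h μ)
    simp only [Function.iterate_fixed hμ, tendsto_const_nhds]
  · rintro rfl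
    refine tendsto_nhds_unique ?_ (h μ)
    refine (tendsto_add_atTop_iff_nat 1).1 ?_
    simp only [Function.iterate_succ_apply']
    exact (hS.tendsto μ).comp (h μ)

end Orbits

/-! ### Splicing words -/

/-- The sequence that follows `a` up to time `n` and then `b`. -/
def splice (n : ℕ) (a b : ℕ → Fin k) (t : ℕ) : Fin k := if t ≤ n then a t else b (t - n)

theorem splice_of_le {n t : ℕ} (a b : ℕ → Fin k) (h : t ≤ n) : splice n a b t = a t := if_pos h

theorem splice_add {n : ℕ} {a b : ℕ → Fin k} (h : b 0 = a n) (t : ℕ) :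
    splice n a b (n + t) = b t := by
  rcases t.eq_zero_or_pos with rfl | ht
  · exact (splice_of_le a b le_rfl).trans h.symm
  · rw [splice, if_neg (by lia), Nat.add_sub_cancel_left]

theorem cyl_splice_subset (n m : ℕ) (a b : ℕ → Fin k) : cyl (splice n a b) (n + m) ⊆ cyl a n :=
  fun _ hξ i hi => (hξ i (by lia)).trans (splice_of_le a b hi)

theorem MarkovData.measure_cyl_splice (M : MarkovData k) {n m : ℕ} {a b : ℕ → Fin k}
    (h : b 0 = a n) : M.measure (cyl (splice n a b) (n + m)) =
      ENNReal.ofReal (∏ t ∈ Finset.range m, M.P (b t) (b (t + 1))) * M.measure (cyl a n) :=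
  M.measure_cyl_append a b _ n m (fun _ ht => splice_of_le a b ht) fun t _ => splice_add h t

/-- In a mixing Markov shift, any two symbols are joined by admissible words of a common length. -/
theorem MarkovData.exists_joining_words (M : MarkovData k) (hp : ∀ i, 0 < M.p i)
    (hmix : IsMixing shift M.measure) (i : Fin k) :
    ∃ r, ∀ j, ∃ b : ℕ → Fin k, b 0 = j ∧ b (r + 1) = i ∧
      0 < ∏ t ∈ Finset.range (r + 1), M.P (b t) (b (t + 1)) := by
  have h : ∀ j, ∀ᶠ n : ℕ in atTop,
      0 < M.measure (shift^[n] ⁻¹' {ξ | ξ 0 = i} ∩ {ξ | ξ 0 = j}) := fun j => by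
    refine (hmix.2 _ _ (measurableSet_symbol 0 i) (measurableSet_symbol 0 j)).eventually_const_lt ?_
    rw [measure_symbol_zero, measure_symbol_zero]
    exact ENNReal.mul_pos (ENNReal.ofReal_pos.2 (hp i)).ne' (ENNReal.ofReal_pos.2 (hp j)).ne'
  obtain ⟨n, hn, hn1⟩ := ((eventually_all.2 h).and (eventually_ge_atTop 1)).exists
  obtain ⟨r, rfl⟩ : ∃ r, n = r + 1 := ⟨n - 1, by lia⟩
  refine ⟨r, fun j => ?_⟩
  obtain ⟨b, ⟨hb1, hb0⟩, hb⟩ := exists_mem_measure_cyl_pos (hn j) (r + 1)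
  refine ⟨b, hb0, ?_, M.prod_pos_of_measure_cyl_pos hb⟩
  rw [mem_preimage, mem_ofPred_eq, shift_iterate_apply, zero_add] at hb1
  exact hb1

/-! ### Points are almost surely left out by the nested images -/

section Splitting

variable {X : Type*} [MetricSpace X]

theorem compSeq_splice (T : Fin k → C(X, X)) {n : ℕ} {a b : ℕ → Fin k} (h : b 0 = a (n + 1))
    (m : ℕ) :
    compSeq T (splice (n + 1) a b) (n + 1 + m) = (compSeq T a n).comp (compSeq T b m) := by
  induction m with
  | zero =>
    have h0 : splice (n + 1) a b (n + 1) = b 0 := splice_add h 0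
    simp only [compSeq]
    rw [h0, compSeq_congr T fun i hi => splice_of_le a b (by lia)]
  | succ m ih =>
    rw [← add_assoc, compSeq, ih, add_assoc (n + 1), splice_add h]
    rfl

theorem antitone_range_compSeq (T : Fin k → C(X, X)) (ξ : ℕ → Fin k) :
    Antitone fun n => range (compSeq T ξ n) := antitone_nat_of_succ_le fun n => by
  rintro _ ⟨y, rfl⟩
  exact ⟨T (ξ (n + 1)) y, rfl⟩

theorem mapsTo_injOn_compSeq {T : Fin k → C(X, X)} {J : Set X}
    (hJ : ∀ i, MapsTo (T i) J J ∧ InjOn (T i) J) (ξ : ℕ → Fin k) (n : ℕ) :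
    MapsTo (compSeq T ξ n) J J ∧ InjOn (compSeq T ξ n) J := by
  induction n with
  | zero => exact hJ (ξ 0)
  | succ n ih =>
    exact ⟨ih.1.comp (hJ _).1, ih.2.comp (hJ _).2 (hJ _).1⟩

/-- The sequences for which `x` lies in the image of `T_{ξ₀} ∘ ⋯ ∘ T_{ξₙ}`. -/
def hitting (T : Fin k → C(X, X)) (x : X) (n : ℕ) : Set (ℕ → Fin k) :=
  {ξ | x ∈ range (compSeq T ξ n)}

theorem antitone_hitting (T : Fin k → C(X, X)) (x : X) : Antitone (hitting T x) :=
  fun _ _ h ξ hξ => antitone_range_compSeq T ξ h hξ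

theorem dependsOn_hitting (T : Fin k → C(X, X)) (x : X) (n : ℕ) :
    DependsOn (· ∈ hitting T x n) (Set.Iic n) := fun ξ η h => by
  simp only [hitting, mem_ofPred_eq]
  rw [compSeq_congr T fun i hi => h i hi]

theorem measurableSet_hitting (T : Fin k → C(X, X)) (x : X) (n : ℕ) :
    MeasurableSet (hitting T x n) := by
  have h := (isOpen_preimage_of_dependsOn (dependsOn_hitting T x n) {True}).measurableSet
  have he : (· ∈ hitting T x n) ⁻¹' {True} = hitting T x n := by
    ext
    simp
  rwa [he] at h

variable {T : Fin k → C(X, X)} {M : MarkovData k} {J : Set X} {u v : ℕ → Fin k} {l s : ℕ}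

/-- Every word has, up to a bounded length, a continuation of uniformly positive conditional
probability along which a given point leaves the images. -/
theorem exists_uniform_escape (hp : ∀ i, 0 < M.p i) (hmix : IsMixing shift M.measure)
    (hJ : ∀ i, MapsTo (T i) J J ∧ InjOn (T i) J) (hu : 0 < M.measure (cyl u l))
    (hv : 0 < M.measure (cyl v s)) (huv : u 0 = v 0)
    (hd : Disjoint (range (compSeq T u l)) (range (compSeq T v s)))
    (huJ : range (compSeq T u l) ⊆ J) (hvJ : range (compSeq T v s) ⊆ J) :
    ∃ δ : ℝ, 0 < δ ∧ ∃ N : ℕ, ∀ (x : X) (n : ℕ) (a : ℕ → Fin k),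
      ENNReal.ofReal δ * M.measure (cyl a n) ≤
        M.measure (cyl a n ∩ (hitting T x (n + N))ᶜ) := by
  obtain ⟨r, hr⟩ := M.exists_joining_words hp hmix (u 0)
  choose b hb0 hbr hbpos using hr
  set α : ℝ := min (∏ t ∈ Finset.range l, M.P (u t) (u (t + 1)))
    (∏ t ∈ Finset.range s, M.P (v t) (v (t + 1))) with hα
  have hα0 : 0 < α :=
    lt_min (M.prod_pos_of_measure_cyl_pos hu) (M.prod_pos_of_measure_cyl_pos hv)
  have : Nonempty (Fin k) := ⟨u 0⟩
  obtain ⟨j₀, hj₀⟩ := Finite.exists_min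
    fun j => ∏ t ∈ Finset.range (r + 1), M.P (b j t) (b j (t + 1))
  set β := ∏ t ∈ Finset.range (r + 1), M.P (b j₀ t) (b j₀ (t + 1)) with hβ
  have hβ0 : 0 < β := hbpos j₀
  refine ⟨α * β, mul_pos hα0 hβ0, r + 1 + max l s, fun x n a => ?_⟩
  set e := splice n a (b (a n)) with he
  have heu : u 0 = e (n + r + 1) := by
    rw [he, add_assoc, splice_add (hb0 _), hbr]
  have hemeas : ENNReal.ofReal β * M.measure (cyl a n) ≤ M.measure (cyl e (n + r + 1)) := by
    rw [he, add_assoc, M.measure_cyl_splice (hb0 _)]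
    gcongr
    exact hj₀ _
  have main : ∀ (w : ℕ → Fin k) (m : ℕ), w 0 = u 0 → m ≤ max l s →
      α ≤ ∏ t ∈ Finset.range m, M.P (w t) (w (t + 1)) →
      x ∉ range ((compSeq T e (n + r)).comp (compSeq T w m)) →
      ENNReal.ofReal (α * β) * M.measure (cyl a n) ≤
        M.measure (cyl a n ∩ (hitting T x (n + (r + 1 + max l s)))ᶜ) := by
    intro w m hw hm hαw hx
    have hwe : w 0 = e (n + r + 1) := hw.trans heu
    calc ENNReal.ofReal (α * β) * M.measure (cyl a n)
        = ENNReal.ofReal α * (ENNReal.ofReal β * M.measure (cyl a n)) := by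
          rw [ENNReal.ofReal_mul hα0.le, mul_assoc]
      _ ≤ ENNReal.ofReal (∏ t ∈ Finset.range m, M.P (w t) (w (t + 1))) *
            M.measure (cyl e (n + r + 1)) := by gcongr
      _ = M.measure (cyl (splice (n + r + 1) e w) (n + r + 1 + m)) :=
          (M.measure_cyl_splice hwe).symm
      _ ≤ _ := by
          refine measure_mono (subset_inter ?_ fun ξ hξ hhit => hx ?_)
          · exact (cyl_splice_subset _ _ _ _).trans (by
              rw [add_assoc]; exact cyl_splice_subset _ _ _ _)
          · have h := antitone_hitting T x
              (show n + r + 1 + m ≤ n + (r + 1 + max l s) by lia) hhit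
            rw [hitting, mem_ofPred_eq, compSeq_congr T hξ, compSeq_splice T hwe] at h
            exact h
  by_cases hxu : x ∈ range ((compSeq T e (n + r)).comp (compSeq T u l))
  · refine main v s huv.symm (le_max_right _ _) (min_le_right _ _) fun hxv => ?_
    obtain ⟨y, hy⟩ := hxu
    obtain ⟨z, hz⟩ := hxv
    have hyz := (mapsTo_injOn_compSeq hJ e (n + r)).2 (huJ (mem_range_self y))
      (hvJ (mem_range_self z)) (hy.trans hz.symm)
    exact disjoint_left.1 hd (mem_range_self y) (hyz ▸ mem_range_self z)
  · exact main u l rfl (le_max_left _ _) (min_le_left _ _) hxu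

/-- For a Markov measure that splits the system, every point is almost surely outside some image
`T_{ξ₀} ∘ ⋯ ∘ T_{ξₙ}(X)`. -/
theorem measure_iInter_hitting (hp : ∀ i, 0 < M.p i) (hmix : IsMixing shift M.measure)
    (hJ : ∀ i, MapsTo (T i) J J ∧ InjOn (T i) J) (hu : 0 < M.measure (cyl u l))
    (hv : 0 < M.measure (cyl v s)) (huv : u 0 = v 0)
    (hd : Disjoint (range (compSeq T u l)) (range (compSeq T v s)))
    (huJ : range (compSeq T u l) ⊆ J) (hvJ : range (compSeq T v s) ⊆ J) (x : X) :
    M.measure (⋂ n, hitting T x n) = 0 := by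
  obtain ⟨δ, hδ, N, hN⟩ := exists_uniform_escape hp hmix hJ hu hv huv hd huJ hvJ
  have hlim : Tendsto (fun n => M.measure (hitting T x n)) atTop
      (𝓝 (M.measure (⋂ n, hitting T x n))) := tendsto_measure_iInter_atTop
    (fun n => (measurableSet_hitting T x n).nullMeasurableSet) (antitone_hitting T x)
    ⟨0, measure_ne_top _ _⟩
  have hstep : ∀ n, ENNReal.ofReal δ * M.measure (hitting T x n) +
      M.measure (hitting T x (n + N)) ≤ M.measure (hitting T x n) := fun n => by
    have h1 := mul_measure_le_of_cyl (dependsOn_hitting T x n) (ENNReal.ofReal δ)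
      fun a _ => hN x n a
    have h2 := measure_inter_add_sdiff (μ := M.measure) (hitting T x n)
      (measurableSet_hitting T x (n + N))
    rw [inter_eq_self_of_subset_right (antitone_hitting T x (Nat.le_add_right n N)), add_comm,
      sdiff_eq] at h2
    rw [← h2]
    gcongr
    rw [h2]
    exact h1
  have hle := le_of_tendsto_of_tendsto' ((ENNReal.Tendsto.const_mul hlim
    (Or.inr ENNReal.ofReal_ne_top)).add (hlim.comp (tendsto_add_atTop_nat N))) hlim hstep
  have hzero : ENNReal.ofReal δ * M.measure (⋂ n, hitting T x n) ≤ 0 :=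
    (ENNReal.add_le_add_iff_right (measure_ne_top M.measure (⋂ n, hitting T x n))).1
      (by rwa [zero_add])
  exact (mul_eq_zero.1 (le_antisymm hzero bot_le)).resolve_left (ENNReal.ofReal_pos.2 hδ).ne'

end Splitting

/-! ### Weak hyperbolicity of systems on the interval -/

/-- An order connected subset of `[0, 1]` that avoids the fractions `i / m` is small. -/
theorem diam_le_of_forall_fraction_notMem {A : Set I} (hA : A.OrdConnected) {m : ℕ} (hm : 0 < m)
    (h : ∀ q : I, (∃ i : ℕ, (q : ℝ) = i / m) → q ∉ A) : Metric.diam A ≤ 1 / m := by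
  have hm' : (0 : ℝ) < m := Nat.cast_pos.2 hm
  have key : ∀ y ∈ A, ∀ z ∈ A, y ≤ z → (z : ℝ) - y ≤ 1 / m := by
    intro y hy z hz hyz
    by_contra! hlt
    have h1 : (y : ℝ) * m < ⌊(y : ℝ) * m⌋₊ + 1 := Nat.lt_floor_add_one _
    have h2 : (⌊(y : ℝ) * m⌋₊ : ℝ) ≤ y * m := Nat.floor_le (mul_nonneg y.2.1 hm'.le)
    set f := ⌊(y : ℝ) * m⌋₊
    have hyq : (y : ℝ) ≤ ((f + 1 : ℕ) : ℝ) / m := by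
      rw [le_div_iff₀ hm']
      push_cast
      exact h1.le
    have hqz : ((f + 1 : ℕ) : ℝ) / m ≤ z := by
      rw [div_lt_iff₀ hm'] at hlt
      rw [div_le_iff₀ hm']
      push_cast
      nlinarith
    exact h ⟨_, y.2.1.trans hyq, hqz.trans z.2.2⟩ ⟨f + 1, rfl⟩ (hA.out hy hz ⟨hyq, hqz⟩)
  refine Metric.diam_le_of_forall_dist_le (by positivity) fun y hy z hz => ?_
  rw [Subtype.dist_eq, Real.dist_eq]
  rcases le_total y z with hyz | hyz
  · rw [abs_sub_comm, abs_of_nonneg (sub_nonneg.2 (Subtype.coe_le_coe.2 hyz))]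
    exact key y hy z hz hyz
  · rw [abs_of_nonneg (sub_nonneg.2 (Subtype.coe_le_coe.2 hyz))]
    exact key z hz y hy hyz

/-- If no point lies in all the images `T_{ξ₀} ∘ ⋯ ∘ T_{ξₙ}(I)` up to a null set of sequences
depending on the point, then almost every sequence is weakly hyperbolic. -/
theorem ae_mem_weaklyHyperbolic (T : Fin k → C(I, I)) {μ : Measure (ℕ → Fin k)}
    (h : ∀ x, μ (⋂ n, hitting T x n) = 0) : ∀ᵐ ξ ∂μ, ξ ∈ weaklyHyperbolic T := by
  have hfrac : {q : I | ∃ m i : ℕ, (q : ℝ) = i / m}.Countable := by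
    refine ((countable_range fun p : ℕ × ℕ => (p.2 / p.1 : ℝ)).preimage
      Subtype.val_injective).mono ?_
    rintro q ⟨m, i, hq⟩
    exact ⟨(m, i), hq.symm⟩
  have hae : ∀ᵐ ξ ∂μ, ∀ q ∈ {q : I | ∃ m i : ℕ, (q : ℝ) = i / m}, ξ ∉ ⋂ n, hitting T q n :=
    (ae_ball_iff hfrac).2 fun q _ => measure_eq_zero_iff_ae_notMem.1 (h q)
  filter_upwards [hae] with ξ hξ
  have hev : ∀ m : ℕ, 0 < m → ∀ᶠ n in atTop,
      ∀ q ∈ {q : I | ∃ i : ℕ, (q : ℝ) = i / m}, q ∉ range (compSeq T ξ n) := by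
    intro m hm
    have hfin : {q : I | ∃ i : ℕ, (q : ℝ) = i / m}.Finite := by
      refine (((Set.finite_Iic m).image fun i : ℕ => (i / m : ℝ)).preimage
        Subtype.val_injective.injOn).subset ?_
      rintro q ⟨i, hi⟩
      refine ⟨i, ?_, hi.symm⟩
      have := q.2.2
      rw [hi, div_le_one (Nat.cast_pos.2 hm)] at this
      exact mem_Iic.2 (Nat.cast_le.1 this)
    refine hfin.eventually_all.2 ?_
    rintro q ⟨i, hi⟩
    have := hξ q ⟨m, i, hi⟩
    rw [mem_iInter, not_forall] at this
    obtain ⟨n₀, hn₀⟩ := this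
    filter_upwards [eventually_ge_atTop n₀] with n hn hq
    exact hn₀ (antitone_range_compSeq T ξ hn hq)
  refine Metric.tendsto_atTop.2 fun ε hε => ?_
  obtain ⟨m, hm⟩ := exists_nat_one_div_lt hε
  obtain ⟨n₀, hn₀⟩ := eventually_atTop.1 (hev (m + 1) m.succ_pos)
  refine ⟨n₀, fun n hn => ?_⟩
  rw [Real.dist_eq, sub_zero, abs_of_nonneg Metric.diam_nonneg]
  refine (diam_le_of_forall_fraction_notMem
    (isPreconnected_range (compSeq T ξ n).continuous).ordConnected m.succ_pos
    fun q hq => hn₀ n hn q hq).trans_lt ?_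
  push_cast
  exact hm

end RecurrentIFS

theorem theorem6 (k : ℕ) (hk : 2 ≤ k) (T : Fin k → C(I, I)) (M : MarkovData k)
    (hirr : M.P.IsIrreducible)
    (hmix : IsMixing shift (M.inverse hirr).measure)
    (hsplit : ∃ a b : I, a < b ∧ Splits T (M.inverse hirr) a b) :
    IsAsymptoticallyStable (markovOperator T M) ∧
    (M.inverse hirr).measure (weaklyHyperbolic T) = 1 ∧
    Measurable (genCoding T) ∧
    ∃ ν : ProbabilityMeasure (I × Fin k),
      (ν : Measure (I × Fin k)) =
        ((M.inverse hirr).measure.comap (Subtype.val : weaklyHyperbolic T → ℕ → Fin k)).map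
          (genCoding T) ∧
      (∀ μ : ProbabilityMeasure (I × Fin k), markovOperator T M μ = μ ↔ μ = ν) ∧
      ∀ μ : ProbabilityMeasure (I × Fin k),
        Tendsto (fun n : ℕ => (markovOperator T M)^[n] μ) atTop (𝓝 ν) := by
  obtain ⟨a, b, -, hJ, u, v, l, s, hu, hv, huv, hd, hsub⟩ := hsplit
  have hT : ∀ᵐ ξ ∂(M.inverse hirr).measure, ξ ∈ weaklyHyperbolic T :=
    ae_mem_weaklyHyperbolic T (measure_iInter_hitting (M.p_pos hirr) hmix hJ hu hv huv hd
      (union_subset_iff.1 hsub).1 (union_subset_iff.1 hsub).2)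
  have hone : (M.inverse hirr).measure (weaklyHyperbolic T) = 1 :=
    (mem_ae_iff_prob_eq_one (measurableSet_weaklyHyperbolic T)).1 hT
  let ν : ProbabilityMeasure (I × Fin k) :=
    ⟨codingLaw T (M.inverse hirr).measure, isProbabilityMeasure_codingLaw T hone⟩
  have hconv := tendsto_markovOperator_iterate T M hirr hmix hT ν rfl
  have hfix := fixed_iff_of_tendsto_iterate (continuous_markovOperator T M) hconv
  exact ⟨⟨ν, (hfix ν).2 rfl, hconv⟩, hone, measurable_genCoding T, ν, rfl, hfix, hconv⟩
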